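/- Let $\mathcal{V}$ be a symmetric monoidal closed category and let $\lambda$ be a regular cardinal. Call $\mathcal{V}$ a \emph{locally $\lambda$-presentable base} if $\mathcal{V}$ is locally $\lambda$-presentable, the unit of the tensor product is a $\lambda$-presentable object, and the tensor product of any two $\lambda$-presentable objects of $\mathcal{V}$ is $\lambda$-presentable. Call $\mathcal{V}$ a \emph{locally presentable base} if it is a locally $\lambda$-presentable base for some regular cardinal $\lambda$. \textbf{Corollary} (T. Campion). Let $\mathcal{K}$ be a locally presentable category which is cartesian closed. Then $\mathcal{K}$, equipped with the symmetric monoidal closed structure given by the binary product (with the terminal object as unit), is a locally presentable base. -/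

import Mathlib

universe w v u

namespace CategoryTheory

open MonoidalCategory

/-- Let `κ` be a regular cardinal. A symmetric monoidal closed category `V` is a locally
`κ`-presentable base if it is locally `κ`-presentable, if its unit object is `κ`-presentable, and
if the tensor product of any two `κ`-presentable objects is `κ`-presentable. -/
structure IsCardinalLocallyPresentableBase (V : Type u) [Category.{v} V] [MonoidalCategory V]
    [SymmetricCategory V] [MonoidalClosed V] (κ : Cardinal.{w}) [Fact κ.IsRegular] : Prop where
  isCardinalLocallyPresentable : IsCardinalLocallyPresentable V κ
  isCardinalPresentable_unit : IsCardinalPresentable (𝟙_ V) κ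
  isCardinalPresentable_tensor : ∀ X Y : V, IsCardinalPresentable X κ →
    IsCardinalPresentable Y κ → IsCardinalPresentable (X ⊗ Y) κ

/-- A symmetric monoidal closed category `V` is a locally presentable base (relative to the
universe `w` of small sets) if it is a locally `κ`-presentable base for some regular cardinal
`κ`. -/
def IsLocallyPresentableBase (V : Type u) [Category.{v} V] [MonoidalCategory V]
    [SymmetricCategory V] [MonoidalClosed V] : Prop :=
  ∃ (κ : Cardinal.{w}) (_ : Fact κ.IsRegular), IsCardinalLocallyPresentableBase V κ

end CategoryTheory

namespace CategoryTheory

open Limits MonoidalCategory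

/-! Nothing is special to products. Closedness makes `⊗` cocontinuous in each variable, and
`κ`-presentable objects are the `κ`-small colimit closure of a small strong generator of
`κ`-presentables. So it suffices that the unit and the pairwise tensors of generators be
`κ`-presentable: a small family of presentable objects, hence one large `κ` serves for all. -/

/-- A small family of regular cardinals is bounded by a regular cardinal. -/
lemma exists_isRegular_forall_le {ι : Type w} (c : ι → Cardinal.{w}) :
    ∃ κ : Cardinal.{w}, κ.IsRegular ∧ ∀ i, c i ≤ κ := by
  obtain ⟨κ, hκ, h⟩ := HasCardinalLT.exists_regular_cardinal_forall.{w}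
    (fun i ↦ (c i).ord.ToType)
  exact ⟨κ, hκ, fun i ↦ le_of_lt (by simpa [hasCardinalLT_iff_cardinal_mk_lt] using h i)⟩

/-- A small family of presentable objects is uniformly `κ`-presentable for some regular cardinal
`κ`, which may be taken above any given cardinal. -/
lemma exists_isCardinalPresentable_of_small_family {C : Type u} [Category.{v} C]
    {ι : Type w} (X : ι → C) [∀ i, IsPresentable.{w} (X i)] (κ₀ : Cardinal.{w}) :
    ∃ (κ : Cardinal.{w}) (_ : Fact κ.IsRegular), κ₀ ≤ κ ∧ ∀ i, IsCardinalPresentable (X i) κ := by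
  choose c hc hc' using fun i ↦ Functor.IsAccessible.exists_cardinal.{w}
    (F := coyoneda.obj (Opposite.op (X i)))
  obtain ⟨κ, hκ, h⟩ := exists_isRegular_forall_le (fun i : Option ι ↦ i.elim κ₀ c)
  have : Fact κ.IsRegular := ⟨hκ⟩
  refine ⟨κ, inferInstance, h none, fun i ↦ ?_⟩
  have := hc i
  have := hc' i
  exact isCardinalPresentable_of_le (κ := c i) (X i) (h (some i))

/-- A functor preserving small colimits which sends a property `P` to `κ`-presentable objects also
sends the closure of `P` under `κ`-small colimits to `κ`-presentable objects. -/
lemma isCardinalPresentable_obj_of_colimitsCardinalClosure {C D : Type*} [Category* C] [Category* D]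
    [LocallySmall.{w} D] (F : C ⥤ D) [PreservesColimitsOfSize.{w, w} F]
    (P : ObjectProperty C) (κ : Cardinal.{w}) [Fact κ.IsRegular]
    (hP : ∀ X, P X → IsCardinalPresentable (F.obj X) κ) (X : C)
    (hX : P.colimitsCardinalClosure κ X) : IsCardinalPresentable (F.obj X) κ := by
  have h : P.colimitsCardinalClosure κ ≤ (isCardinalPresentable D κ).inverseImage F := by
    refine P.colimitsCardinalClosure_le κ (fun J _ hJ ↦ ⟨?_⟩) hP
    rintro Y ⟨p⟩
    have (j : J) : IsCardinalPresentable ((p.diag ⋙ F).obj j) κ := p.prop_diag_obj j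
    exact isCardinalPresentable_of_isColimit _ (isColimitOfPreserves F p.isColimit) κ hJ
  exact h X hX

/-- If the pairwise tensor products of a strong generator consisting of `κ`-presentable objects
are `κ`-presentable, then `κ`-presentable objects are stable under tensor products. -/
lemma isCardinalPresentable_tensorObj_of_isStrongGenerator {V : Type u} [Category.{v} V]
    [MonoidalCategory V] [SymmetricCategory V] [MonoidalClosed V]
    [HasColimitsOfSize.{w, w} V] [LocallySmall.{w} V] (κ : Cardinal.{w}) [Fact κ.IsRegular]
    (P : ObjectProperty V) [ObjectProperty.Small.{w} P] (hP : P.IsStrongGenerator)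
    (hPκ : P ≤ isCardinalPresentable V κ)
    (hPP : ∀ X Y, P X → P Y → IsCardinalPresentable (X ⊗ Y) κ)
    (X Y : V) [IsCardinalPresentable X κ] [IsCardinalPresentable Y κ] :
    IsCardinalPresentable (X ⊗ Y) κ := by
  have mem (Z : V) [hZ : IsCardinalPresentable Z κ] : P.colimitsCardinalClosure κ Z := by
    rwa [← IsStrongGenerator.colimitsCardinalClosure_eq_isCardinalPresentable hP hPκ]
  have preserves (Z : V) : PreservesColimitsOfSize.{w, w} (tensorLeft Z) :=
    (ihom.adjunction Z).leftAdjoint_preservesColimits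
  -- Reduce `Y` to a generator `Z`, then `X` to a generator `W`; the braiding lets `tensorLeft`
  -- serve for both variables.
  refine isCardinalPresentable_obj_of_colimitsCardinalClosure (tensorLeft X) P κ
    (fun Z hZ ↦ ?_) Y (mem Y)
  have : IsCardinalPresentable (Z ⊗ X) κ :=
    isCardinalPresentable_obj_of_colimitsCardinalClosure (tensorLeft Z) P κ
      (fun W hW ↦ hPP Z W hZ hW) X (mem X)
  exact isCardinalPresentable_of_iso (β_ Z X) κ

/-- Any symmetric monoidal closed locally presentable category is a locally presentable base. -/
theorem isLocallyPresentableBase_of_isLocallyPresentable (V : Type u) [Category.{v} V]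
    [MonoidalCategory V] [SymmetricCategory V] [MonoidalClosed V] [IsLocallyPresentable.{w} V] :
    IsLocallyPresentableBase.{w} V := by
  obtain ⟨κ₀, _, _⟩ := IsLocallyPresentable.exists_cardinal.{w} V
  obtain ⟨P, _, hP⟩ := HasCardinalFilteredGenerator.exists_small_generator V κ₀
  let e := equivShrink.{w} (Subtype P)
  -- `none` adds the unit to the pairwise tensors; shrinking puts the index in `Type w`, as a common
  -- bound requires.
  let T : Option (Shrink.{w} (Subtype P) × Shrink.{w} (Subtype P)) → V :=
    fun i ↦ i.elim (𝟙_ V) (fun p ↦ (e.symm p.1).1 ⊗ (e.symm p.2).1)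
  obtain ⟨κ, _, le, hκ⟩ := exists_isCardinalPresentable_of_small_family T κ₀
  refine ⟨κ, inferInstance, .of_le V le, hκ none, fun X Y _ _ ↦ ?_⟩
  refine isCardinalPresentable_tensorObj_of_isStrongGenerator κ P hP.isStrongGenerator
    (hP.le_isCardinalPresentable.trans (isCardinalPresentable_monotone V le))
    (fun X Y hX hY ↦ ?_) X Y
  simpa [T] using hκ (some (e ⟨X, hX⟩, e ⟨Y, hY⟩))

end CategoryTheory

/-- A cartesian closed locally presentable category is a locally presentable base for its
cartesian monoidal structure. The braiding is the usual symmetry of the product: a cartesian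
monoidal category has exactly one braiding, and it is symmetric. -/
theorem mainTheorem8 (K : Type u) [CategoryTheory.Category.{v} K]
    [CategoryTheory.CartesianMonoidalCategory K] [CategoryTheory.BraidedCategory K]
    [CategoryTheory.MonoidalClosed K] [CategoryTheory.IsLocallyPresentable.{w} K] :
    CategoryTheory.IsLocallyPresentableBase.{w} K :=
  CategoryTheory.isLocallyPresentableBase_of_isLocallyPresentable K
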